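/- Let $m>1$ and $r>0$ be integers, let $F$ be the free group on $m$ generators, and let $\Phi_{m,r}:=F/F^{(r)}$ be the free solvable group on $m$ generators of solvability length $r$, where $F^{(0)}=F$ and $F^{(i+1)}=[F^{(i)},F^{(i)}]$. For a positive integer $n$ put $K_{0,n}:=F$ and $K_{i+1,n}:=[K_{i,n},K_{i,n}]\,(K_{i,n})^n$, where $(K_{i,n})^n$ is the subgroup generated by the $n$-th powers of elements of $K_{i,n}$, and let $\Phi_{m,r,n}:=F/K_{r,n}$. The kernel of the natural projection $\Phi_{m,r}\to\Phi_{m,r,n}$ is characteristic, so this projection induces a homomorphism $\operatorname{Out}(\Phi_{m,r})\to\operatorname{Out}(\Phi_{m,r,n})$. A finitely generated group $G$ is said to have the congruence subgroup property (CSP) if every finite-index subgroup of $\operatorname{Aut}(G)$ contains $\ker(\operatorname{Aut}(G)\to\operatorname{Aut}(G/K))$ for some characteristic subgroup $K$ of finite index in $G$. Then $\Phi_{m,r}$ has the CSP if and only if every finite-index subgroup of $\operatorname{Out}(\Phi_{m,r})$ contains $\ker(\operatorname{Out}(\Phi_{m,r})\to\operatorname{Out}(\Phi_{m,r,n}))$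 for some positive integer $n$. -/

import Mathlib

section AutOut

/-- The subgroup of inner automorphisms of `G` is normal in `Aut(G)`. -/
instance innNormal (G : Type*) [Group G] : (MulAut.conj : G →* MulAut G).range.Normal where
  conj_mem := by
    rintro _ ⟨g, rfl⟩ a
    refine ⟨a g, ?_⟩
    ext x
    simp

/-- The outer automorphism group `Out(G) = Aut(G) / Inn(G)`. -/
abbrev OutGroup (G : Type*) [Group G] : Type _ :=
  MulAut G ⧸ (MulAut.conj : G →* MulAut G).range

/-- For a characteristic subgroup `K` of `G`, the natural map `Aut(G) → Aut(G/K)`. -/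
def autQuotient {G : Type*} [Group G] (K : Subgroup G) [hK : K.Characteristic] :
    MulAut G →* MulAut (G ⧸ K) where
  toFun a := QuotientGroup.congr K K a (Subgroup.characteristic_iff_map_eq.mp hK a)
  map_one' := by
    ext x
    induction x using QuotientGroup.induction_on with
    | H g => rfl
  map_mul' a b := by
    ext x
    induction x using QuotientGroup.induction_on with
    | H g => rfl

/-- A group `G` has the congruence subgroup property if every subgroup of finite index in `Aut(G)`
contains `ker(Aut(G) → Aut(G/K))` for some characteristic subgroup `K` of finite index in `G`. -/
def HasCSP (G : Type*) [Group G] : Prop :=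
  ∀ H : Subgroup (MulAut G), H.FiniteIndex →
    ∃ (K : Subgroup G) (_ : K.Characteristic), K.FiniteIndex ∧ (autQuotient K).ker ≤ H

/-- For an epimorphism `p : G → Q` with characteristic kernel, the induced map
`Aut(G) → Aut(Q)`. -/
noncomputable def autMap {G Q : Type*} [Group G] [Group Q] (p : G →* Q)
    (hp : Function.Surjective p) [p.ker.Characteristic] : MulAut G →* MulAut Q :=
  (MulAut.congr (QuotientGroup.quotientKerEquivOfSurjective p hp)).toMonoidHom.comp
    (autQuotient p.ker)

theorem autMap_apply {G Q : Type*} [Group G] [Group Q] (p : G →* Q)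
    (hp : Function.Surjective p) [p.ker.Characteristic] (a : MulAut G) (g : G) :
    autMap p hp a (p g) = p (a g) := by
  have h : (QuotientGroup.quotientKerEquivOfSurjective p hp).symm (p g)
      = QuotientGroup.mk' p.ker g := by
    rw [MulEquiv.symm_apply_eq]
    rfl
  change QuotientGroup.quotientKerEquivOfSurjective p hp
    (autQuotient p.ker a ((QuotientGroup.quotientKerEquivOfSurjective p hp).symm (p g))) = _
  rw [h]
  rfl

theorem inn_le_comap_autMap {G Q : Type*} [Group G] [Group Q] (p : G →* Q)
    (hp : Function.Surjective p) [p.ker.Characteristic] :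
    (MulAut.conj : G →* MulAut G).range ≤
      (MulAut.conj : Q →* MulAut Q).range.comap (autMap p hp) := by
  rintro _ ⟨g, rfl⟩
  refine ⟨p g, ?_⟩
  ext x
  obtain ⟨y, rfl⟩ := hp x
  rw [autMap_apply]
  simp

/-- For an epimorphism `p : G → Q` with characteristic kernel, the induced map
`Out(G) → Out(Q)`. -/
noncomputable def outMap {G Q : Type*} [Group G] [Group Q] (p : G →* Q)
    (hp : Function.Surjective p) [p.ker.Characteristic] : OutGroup G →* OutGroup Q :=
  QuotientGroup.map _ _ (autMap p hp) (inn_le_comap_autMap p hp)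

end AutOut

section FreeSolvable

/-- The subgroups `K_{r,n}` of a group `G`: `K_{0,n} = G` and
`K_{r+1,n} = [K_{r,n}, K_{r,n}] (K_{r,n})^n`, where `(K_{r,n})^n` is the subgroup generated by the
`n`-th powers of the elements of `K_{r,n}`. -/
def powSeries (G : Type*) [Group G] (n : ℕ) : ℕ → Subgroup G
  | 0 => ⊤
  | r + 1 => ⁅powSeries G n r, powSeries G n r⁆ ⊔
      Subgroup.closure {y | ∃ x ∈ powSeries G n r, y = x ^ n}

theorem map_powSeries {G H : Type*} [Group G] [Group H] (f : G →* H)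
    (hf : Function.Surjective f) (n r : ℕ) :
    (powSeries G n r).map f = powSeries H n r := by
  induction r with
  | zero => exact Subgroup.map_top_of_surjective f hf
  | succ r ih =>
    simp only [powSeries]
    rw [Subgroup.map_sup, Subgroup.map_commutator, ih, MonoidHom.map_closure]
    congr 2
    rw [← ih]
    ext y
    constructor
    · rintro ⟨_, ⟨x, hx, rfl⟩, rfl⟩
      exact ⟨f x, Subgroup.mem_map_of_mem f hx, map_pow f x n⟩
    · rintro ⟨_, ⟨x, hx, rfl⟩, rfl⟩
      exact ⟨x ^ n, ⟨x, hx, rfl⟩, map_pow f x n⟩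

instance powSeries_characteristic (G : Type*) [Group G] (n r : ℕ) :
    (powSeries G n r).Characteristic :=
  Subgroup.characteristic_iff_map_eq.mpr fun a => map_powSeries a.toMonoidHom a.surjective n r

theorem derivedSeries_le_powSeries (G : Type*) [Group G] (n r : ℕ) :
    derivedSeries G r ≤ powSeries G n r := by
  induction r with
  | zero => exact le_top
  | succ r ih =>
    rw [derivedSeries_succ]
    exact (Subgroup.commutator_mono ih ih).trans le_sup_left

/-- `Φ_{m,r} = F / F^{(r)}`, the free solvable group of solvability length `r` on `m` generators,
where `F` is the free group on `m` generators. -/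
abbrev FreeSolvable (m r : ℕ) : Type :=
  FreeGroup (Fin m) ⧸ derivedSeries (FreeGroup (Fin m)) r

/-- `Φ_{m,r,n} = F / K_{r,n}`, where `F` is the free group on `m` generators. -/
abbrev FreeSolvableMod (m r n : ℕ) : Type :=
  FreeGroup (Fin m) ⧸ powSeries (FreeGroup (Fin m)) n r

/-- The natural projection `Φ_{m,r} → Φ_{m,r,n}`. -/
def freeSolvableProj (m r n : ℕ) : FreeSolvable m r →* FreeSolvableMod m r n :=
  QuotientGroup.map _ _ (MonoidHom.id (FreeGroup (Fin m)))
    (derivedSeries_le_powSeries (FreeGroup (Fin m)) n r)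

theorem freeSolvableProj_surjective (m r n : ℕ) :
    Function.Surjective (freeSolvableProj m r n) := by
  intro y
  induction y using QuotientGroup.induction_on with
  | H g => exact ⟨QuotientGroup.mk' _ g, rfl⟩

theorem freeSolvableProj_ker (m r n : ℕ) :
    (freeSolvableProj m r n).ker = powSeries (FreeSolvable m r) n r := by
  rw [← map_powSeries (QuotientGroup.mk' (derivedSeries (FreeGroup (Fin m)) r))
    (QuotientGroup.mk'_surjective _) n r]
  ext x
  induction x using QuotientGroup.induction_on with
  | H g =>
    constructor
    · intro h
      exact ⟨g, (QuotientGroup.eq_one_iff g).mp h, rfl⟩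
    · rintro ⟨k, hk, hkg⟩
      rw [← hkg]
      exact (QuotientGroup.eq_one_iff k).mpr hk

instance freeSolvableProj_ker_characteristic (m r n : ℕ) :
    (freeSolvableProj m r n).ker.Characteristic := by
  rw [freeSolvableProj_ker]
  infer_instance

/-- The natural map `Out(Φ_{m,r}) → Out(Φ_{m,r,n})`. -/
noncomputable def freeSolvableOutMap (m r n : ℕ) :
    OutGroup (FreeSolvable m r) →* OutGroup (FreeSolvableMod m r n) :=
  outMap (freeSolvableProj m r n) (freeSolvableProj_surjective m r n)

end FreeSolvable

/-! The kernels of Aut and Out differ by inner automorphisms, so everything rests on a statement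
about centers: an element central modulo `K_{r,n}` lies in a prescribed `K_{r,k}` once `n` is
suitably chosen (`exists_forall_central_mem`, for `r ≥ 2`). Given `H` of finite index in Aut, an
automorphism acting trivially modulo a deep `K_{r,N}` is an element of `H` times some `conj g` with
`g` central modulo `K_{r,n}`; hence `g` lies in the finite-index subgroup where `conj` lands in `H`.

The center statement uses signed edge counts in Cayley graphs (Fox derivatives). Modulo `n` they
detect `[R, R] R ^ n` inside `R`. If `g ∈ S` is central modulo `[S, S] S ^ n`, its counts on `F / S`
are translation invariant modulo `n`; summing over the fibers of `F / S → F / R` gains a factor `k`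
(`mem_commutatorPow_of_central`). Induction on `r` starts from `mem_powSeries_one_of_central`. -/

open scoped commutatorElement

/-! ### Edge counts of words in Cayley graphs. -/

section FoxCount

variable {α : Type*}

open Classical in
/-- The affine permutation of the integral edge functions on the Cayley graph of `F / R` given by
translation by the generator `i` followed by adding the edge labelled `i` at the origin. -/
noncomputable def edgeShift (R : Subgroup (FreeGroup α)) [R.Normal] (i : α) :
    Equiv.Perm (α → FreeGroup α ⧸ R → ℤ) where
  toFun v j q := (if j = i ∧ q = 1 then 1 else 0) + v j ((FreeGroup.of i : FreeGroup α ⧸ R)⁻¹ * q)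
  invFun v j q := v j ((FreeGroup.of i : FreeGroup α ⧸ R) * q) -
    (if j = i ∧ (FreeGroup.of i : FreeGroup α ⧸ R) * q = 1 then 1 else 0)
  left_inv v := by
    funext j q
    simp
  right_inv v := by
    funext j q
    simp

/-- The signed number of times that the path of the word `g` in the Cayley graph of `F / R`,
starting at the origin, crosses the edge labelled `i` at `q`. -/
noncomputable def edgeCount (R : Subgroup (FreeGroup α)) [R.Normal] (g : FreeGroup α) :
    α → FreeGroup α ⧸ R → ℤ :=
  FreeGroup.lift (edgeShift R) g 0

variable (R : Subgroup (FreeGroup α)) [R.Normal]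

/-- A word acts by an affine map with linear part translation and constant term its edge count;
composing two such maps gives the Fox product rule `edgeCount_mul`. -/
theorem lift_edgeShift_apply (g : FreeGroup α) (v : α → FreeGroup α ⧸ R → ℤ) (i : α)
    (q : FreeGroup α ⧸ R) :
    FreeGroup.lift (edgeShift R) g v i q
      = edgeCount R g i q + v i ((g : FreeGroup α ⧸ R)⁻¹ * q) := by
  unfold edgeCount
  induction g using FreeGroup.induction_on generalizing v q with
  | C1 => simp
  | of j => simp [edgeShift]
  | inv_of j h => simp [edgeShift, Equiv.symm]; ring
  | mul g h ihg ihh =>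
    rw [map_mul, Equiv.Perm.mul_apply, Equiv.Perm.mul_apply, ihg, ihh,
      ihg (FreeGroup.lift (edgeShift R) h 0)]
    simp [mul_assoc, add_assoc]

theorem edgeCount_mul (g h : FreeGroup α) (i : α) (q : FreeGroup α ⧸ R) :
    edgeCount R (g * h) i q
      = edgeCount R g i q + edgeCount R h i ((g : FreeGroup α ⧸ R)⁻¹ * q) := by
  rw [← lift_edgeShift_apply, edgeCount, map_mul, Equiv.Perm.mul_apply, edgeCount]

@[simp]
theorem edgeCount_one (i : α) (q : FreeGroup α ⧸ R) : edgeCount R 1 i q = 0 := by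
  simp [edgeCount]

open Classical in
theorem edgeCount_of (j i : α) (q : FreeGroup α ⧸ R) :
    edgeCount R (FreeGroup.of j) i q = if i = j ∧ q = 1 then 1 else 0 := by
  simp [edgeCount, edgeShift]

theorem edgeCount_inv (g : FreeGroup α) (i : α) (q : FreeGroup α ⧸ R) :
    edgeCount R g⁻¹ i q = - edgeCount R g i ((g : FreeGroup α ⧸ R) * q) := by
  have h := edgeCount_mul R g⁻¹ g i q
  rw [inv_mul_cancel, edgeCount_one] at h
  simp only [QuotientGroup.mk_inv, inv_inv] at h
  linarith

end FoxCount

/-! ### The subgroups `[R, R] R ^ n` and the series `K_{r,n}`. -/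

/-- The subgroup `[R, R] R ^ n`. -/
def commutatorPow {G : Type*} [Group G] (R : Subgroup G) (n : ℕ) : Subgroup G :=
  ⁅R, R⁆ ⊔ Subgroup.closure {y | ∃ x ∈ R, y = x ^ n}

section CommutatorPow

variable {G : Type*} [Group G] {R S : Subgroup G} {n k : ℕ}

theorem commutator_mem_commutatorPow {x y : G} (hx : x ∈ R) (hy : y ∈ R) :
    ⁅x, y⁆ ∈ commutatorPow R n :=
  Subgroup.mem_sup_left (Subgroup.commutator_mem_commutator hx hy)

theorem pow_mem_commutatorPow {x : G} (hx : x ∈ R) : x ^ n ∈ commutatorPow R n :=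
  Subgroup.mem_sup_right (Subgroup.subset_closure ⟨x, hx, rfl⟩)

theorem commutatorPow_le_iff {L : Subgroup G} :
    commutatorPow R n ≤ L ↔ (∀ x ∈ R, ∀ y ∈ R, ⁅x, y⁆ ∈ L) ∧ ∀ x ∈ R, x ^ n ∈ L := by
  rw [commutatorPow, sup_le_iff, Subgroup.commutator_le, Subgroup.closure_le]
  refine and_congr Iff.rfl ⟨fun h x hx => h ⟨x, hx, rfl⟩, ?_⟩
  rintro h _ ⟨x, hx, rfl⟩
  exact h x hx

theorem commutatorPow_le_self : commutatorPow R n ≤ R :=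
  commutatorPow_le_iff.mpr ⟨fun _ hx _ hy =>
    R.mul_mem (R.mul_mem (R.mul_mem hx hy) (R.inv_mem hx)) (R.inv_mem hy),
    fun _ hx => R.pow_mem hx n⟩

theorem commutatorPow_mono (hSR : S ≤ R) (hkn : k ∣ n) :
    commutatorPow S n ≤ commutatorPow R k := by
  refine commutatorPow_le_iff.mpr ⟨fun x hx y hy =>
    commutator_mem_commutatorPow (hSR hx) (hSR hy), fun x hx => ?_⟩
  obtain ⟨c, rfl⟩ := hkn
  rw [pow_mul]
  exact Subgroup.pow_mem _ (pow_mem_commutatorPow (hSR hx)) c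

theorem powSeries_mono (G : Type*) [Group G] (hkn : k ∣ n) (r : ℕ) :
    powSeries G n r ≤ powSeries G k r := by
  induction r with
  | zero => exact le_rfl
  | succ r ih => exact commutatorPow_mono ih hkn

theorem powSeries_antitone (G : Type*) [Group G] (n : ℕ) : Antitone (powSeries G n) :=
  antitone_nat_of_succ_le fun _ => commutatorPow_le_self

theorem pow_mem_powSeries (x : G) (n r : ℕ) : x ^ n ^ r ∈ powSeries G n r := by
  induction r with
  | zero => trivial
  | succ r ih =>
    rw [pow_succ, pow_mul]
    exact pow_mem_commutatorPow ih

theorem powSeries_le_derivedSeries (h : ∀ x : G, x ^ n = 1) (r : ℕ) :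
    powSeries G n r ≤ derivedSeries G r := by
  induction r with
  | zero => exact le_rfl
  | succ r ih =>
    refine commutatorPow_le_iff.mpr ⟨fun x hx y hy => ?_, fun x _ => ?_⟩
    · exact Subgroup.commutator_mem_commutator (ih hx) (ih hy)
    · rw [h]
      exact one_mem _

/-- In a solvable group of length at most `r` every subgroup of finite index contains some
`K_{r,n}`. -/
theorem exists_powSeries_le {r : ℕ} (hG : derivedSeries G r = ⊥) (L : Subgroup G)
    [L.FiniteIndex] : ∃ n, 0 < n ∧ powSeries G n r ≤ L := by
  have hpos : 0 < Nat.card (G ⧸ L.normalCore) := Nat.card_pos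
  -- The exponent is the order of the finite quotient by the normal core, so all `n`-th powers
  -- vanish there.
  refine ⟨_, hpos, le_trans (fun x hx => ?_) L.normalCore_le⟩
  rw [← QuotientGroup.eq_one_iff, ← Subgroup.mem_bot]
  have hd : derivedSeries (G ⧸ L.normalCore) r = ⊥ := by
    rw [← map_derivedSeries_eq (QuotientGroup.mk'_surjective L.normalCore), hG, Subgroup.map_bot]
  rw [← hd]
  refine powSeries_le_derivedSeries (fun x => pow_card_eq_one') r ?_
  rw [← map_powSeries _ (QuotientGroup.mk'_surjective L.normalCore)]
  exact Subgroup.mem_map_of_mem _ hx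

/-- A finite-index subgroup of a finitely generated group is finitely generated, so `R / [R, R] R ^
n` is finitely generated abelian and torsion, hence finite. -/
theorem finiteIndex_commutatorPow [Group.FG G] (R : Subgroup G) [R.FiniteIndex] (hn : 0 < n) :
    (commutatorPow R n).FiniteIndex := by
  have hle : (commutator R).map R.subtype ≤ commutatorPow R n := by
    rw [Subgroup.map_subtype_commutator]
    exact le_sup_left
  let T : Subgroup R := (commutatorPow R n).subgroupOf R
  have hTc : commutator R ≤ T := fun x hx => hle (Subgroup.mem_map_of_mem _ hx)
  have hT : T.Normal := Subgroup.Normal.of_commutator_le _ hTc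
  let _ : CommGroup (R ⧸ T) :=
    { (inferInstance : Group (R ⧸ T)) with
      mul_comm := by
        intro a b
        induction a using QuotientGroup.induction_on with
        | H a =>
        induction b using QuotientGroup.induction_on with
        | H b =>
        rw [← commutatorElement_eq_one_iff_mul_comm]
        exact (QuotientGroup.eq_one_iff ⁅a, b⁆).mpr
          (commutator_mem_commutatorPow (R := R) a.2 b.2) }
  have hfin : Finite (R ⧸ T) := by
    refine CommGroup.finite_of_fg_isMulTorsion _ fun a => ?_
    induction a using QuotientGroup.induction_on with
    | H a =>
    exact isOfFinOrder_iff_pow_eq_one.mpr ⟨n, hn, (QuotientGroup.eq_one_iff (a ^ n)).mpr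
      (pow_mem_commutatorPow (R := R) a.2)⟩
  have hTi : T.index ≠ 0 := Subgroup.index_ne_zero_of_finite
  refine ⟨?_⟩
  rw [← Subgroup.relIndex_mul_index (commutatorPow_le_self (R := R) (n := n))]
  exact mul_ne_zero hTi Subgroup.FiniteIndex.index_ne_zero

theorem finiteIndex_powSeries (G : Type*) [Group G] [Group.FG G] (hn : 0 < n) (r : ℕ) :
    (powSeries G n r).FiniteIndex := by
  induction r with
  | zero => exact inferInstanceAs (⊤ : Subgroup G).FiniteIndex
  | succ r ih => exact finiteIndex_commutatorPow _ hn

end CommutatorPow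

/-! ### Schreier rewriting: edge counts determine classes in the abelianization of `R`. -/

section Schreier

variable {α : Type*} (R : Subgroup (FreeGroup α)) [R.Normal]

theorem schreier_mem (q : FreeGroup α ⧸ R) (g : FreeGroup α) :
    q.out * g * (q * (g : FreeGroup α ⧸ R)).out⁻¹ ∈ R := by
  rw [← QuotientGroup.eq_one_iff]
  simp

/-- The class in the abelianization of `R` of the Schreier element attached to the coset `q`
and the word `g`. -/
noncomputable def schreierClass (q : FreeGroup α ⧸ R) (g : FreeGroup α) : Abelianization R :=
  Abelianization.of ⟨_, schreier_mem R q g⟩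

theorem schreierClass_mul (q : FreeGroup α ⧸ R) (g h : FreeGroup α) :
    schreierClass R q (g * h) = schreierClass R q g * schreierClass R (q * g) h := by
  rw [schreierClass, schreierClass, schreierClass, ← map_mul]
  congr 1
  ext
  simp [mul_assoc]

theorem schreierClass_one (q : FreeGroup α ⧸ R) : schreierClass R q 1 = 1 := by
  simpa using schreierClass_mul R q 1 1

theorem schreierClass_inv (q : FreeGroup α ⧸ R) (g : FreeGroup α) :
    schreierClass R q g⁻¹ = (schreierClass R (q * (g : FreeGroup α ⧸ R)⁻¹) g)⁻¹ := by
  rw [eq_inv_iff_mul_eq_one, ← QuotientGroup.mk_inv, ← schreierClass_mul, inv_mul_cancel,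
    schreierClass_one]

theorem schreierClass_one_of_mem {g : FreeGroup α} (hg : g ∈ R) :
    schreierClass R 1 g = Abelianization.of ⟨g, hg⟩ := by
  have h1 : (1 : FreeGroup α ⧸ R).out ∈ R := by
    rw [← QuotientGroup.eq_one_iff]
    simp
  have hq : (g : FreeGroup α ⧸ R) = 1 := (QuotientGroup.eq_one_iff g).mpr hg
  have : schreierClass R 1 g
      = Abelianization.of (⟨_, h1⟩ * ⟨g, hg⟩ * (⟨_, h1⟩ : R)⁻¹) := by
    rw [schreierClass]
    congr 1
    ext
    simp [hq]
  rw [this, map_mul, map_mul, map_inv, mul_comm, inv_mul_cancel_left]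

/-- Both sides obey the same cocycle rule in the word, so agreement on generators suffices. -/
theorem schreierClass_eq_prod [Fintype α] [Fintype (FreeGroup α ⧸ R)] (q : FreeGroup α ⧸ R)
    (g : FreeGroup α) :
    schreierClass R q g
      = ∏ i, ∏ p, schreierClass R p (FreeGroup.of i) ^ edgeCount R g i (q⁻¹ * p) := by
  classical
  have hof : ∀ (j : α) (q : FreeGroup α ⧸ R), schreierClass R q (FreeGroup.of j)
      = ∏ i, ∏ p, schreierClass R p (FreeGroup.of i) ^ edgeCount R (FreeGroup.of j) i (q⁻¹ * p) := by
    intro j q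
    rw [Finset.prod_eq_single j, Finset.prod_eq_single q]
    · simp [edgeCount_of]
    · intro p _ hp
      rw [edgeCount_of, if_neg, zpow_zero]
      rintro ⟨-, h⟩
      exact hp (inv_mul_eq_one.mp h).symm
    · simp
    · intro i _ hi
      exact Finset.prod_eq_one fun p _ => by simp [edgeCount_of, hi]
    · simp
  induction g using FreeGroup.induction_on generalizing q with
  | C1 => simp [schreierClass_one]
  | of j => exact hof j q
  | inv_of j h =>
    rw [schreierClass_inv, hof]
    simp_rw [edgeCount_inv, zpow_neg, Finset.prod_inv_distrib]
    simp [mul_assoc]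
  | mul g h ihg ihh =>
    rw [schreierClass_mul, ihg, ihh]
    simp_rw [edgeCount_mul, zpow_add, Finset.prod_mul_distrib]
    simp [mul_assoc]

/-- The edge counts detect `[R, R] R ^ n` among the elements of `R`. -/
theorem mem_commutatorPow_of_dvd_edgeCount [Finite α] [Finite (FreeGroup α ⧸ R)] {n : ℕ}
    {g : FreeGroup α} (hg : g ∈ R) (h : ∀ i q, (n : ℤ) ∣ edgeCount R g i q) :
    g ∈ commutatorPow R n := by
  have := Fintype.ofFinite α
  have := Fintype.ofFinite (FreeGroup α ⧸ R)
  choose e he using h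
  -- Dividing every count by `n` produces an `n`-th root of the class of `g`.
  obtain ⟨y, hy⟩ : ∃ y : R, Abelianization.of y
      = ∏ i, ∏ p, schreierClass R p (FreeGroup.of i) ^ e i p :=
    QuotientGroup.mk'_surjective (commutator R) _
  have key : Abelianization.of (⟨g, hg⟩ : R) = Abelianization.of (y ^ n) := by
    rw [← schreierClass_one_of_mem, schreierClass_eq_prod, map_pow, hy, ← Finset.prod_pow]
    refine Finset.prod_congr rfl fun i _ => ?_
    rw [← Finset.prod_pow]
    refine Finset.prod_congr rfl fun p _ => ?_
    rw [inv_one, one_mul, he, mul_comm, zpow_mul, zpow_natCast]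
  have hc : (⟨g, hg⟩ : R) * (y ^ n)⁻¹ ∈ commutator R := by
    rw [← Abelianization.ker_of, MonoidHom.mem_ker, map_mul, map_inv, key, mul_inv_cancel]
  have hc' : g * ((y : FreeGroup α) ^ n)⁻¹ ∈ commutatorPow R n := by
    refine Subgroup.mem_sup_left ?_
    rw [← Subgroup.map_subtype_commutator]
    exact Subgroup.mem_map_of_mem R.subtype hc
  simpa using mul_mem hc' (pow_mem_commutatorPow (n := n) y.2)

end Schreier

/-! ### Edge counts modulo `n`, and passage from `F / S` to `F / R`. -/

section EdgeCountMod

variable {α : Type*} {R S : Subgroup (FreeGroup α)} [R.Normal] [S.Normal] {n k : ℕ}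

theorem edgeCount_mul_of_mem {g : FreeGroup α} (hg : g ∈ R) (h : FreeGroup α) (i : α)
    (q : FreeGroup α ⧸ R) :
    edgeCount R (g * h) i q = edgeCount R g i q + edgeCount R h i q := by
  rw [edgeCount_mul, (QuotientGroup.eq_one_iff g).mpr hg, inv_one, one_mul]

theorem edgeCount_inv_of_mem {g : FreeGroup α} (hg : g ∈ R) (i : α) (q : FreeGroup α ⧸ R) :
    edgeCount R g⁻¹ i q = - edgeCount R g i q := by
  rw [edgeCount_inv, (QuotientGroup.eq_one_iff g).mpr hg, one_mul]

theorem edgeCount_pow_of_mem {g : FreeGroup α} (hg : g ∈ R) (i : α) (q : FreeGroup α ⧸ R) :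
    edgeCount R (g ^ n) i q = n * edgeCount R g i q := by
  induction n with
  | zero => simp
  | succ n ih =>
    rw [pow_succ, edgeCount_mul_of_mem (R.pow_mem hg n), ih]
    push_cast
    ring

/-- Restricted to `R`, each edge count is a homomorphism to `ℤ`: it kills commutators and sends
`n`-th powers to multiples of `n`. -/
theorem dvd_edgeCount_of_mem_commutatorPow {g : FreeGroup α} (hg : g ∈ commutatorPow R n) (i : α)
    (q : FreeGroup α ⧸ R) : (n : ℤ) ∣ edgeCount R g i q := by
  let L : Subgroup (FreeGroup α) :=
    { carrier := {g | g ∈ R ∧ (n : ℤ) ∣ edgeCount R g i q}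
      one_mem' := ⟨R.one_mem, by simp⟩
      mul_mem' := fun ha hb => ⟨R.mul_mem ha.1 hb.1, by
        rw [edgeCount_mul_of_mem ha.1]
        exact dvd_add ha.2 hb.2⟩
      inv_mem' := fun ha => ⟨R.inv_mem ha.1, by
        rw [edgeCount_inv_of_mem ha.1]
        exact ha.2.neg_right⟩ }
  have hL : commutatorPow R n ≤ L := by
    refine commutatorPow_le_iff.mpr ⟨fun x hx y hy => ⟨commutatorPow_le_self (n := n)
      (commutator_mem_commutatorPow hx hy), ?_⟩, fun x hx => ⟨R.pow_mem hx n, ?_⟩⟩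
    · rw [commutatorElement_def, edgeCount_mul_of_mem (mul_mem (mul_mem hx hy) (inv_mem hx)),
        edgeCount_mul_of_mem (mul_mem hx hy), edgeCount_mul_of_mem hx, edgeCount_inv_of_mem hx,
        edgeCount_inv_of_mem hy]
      simp
    · rw [edgeCount_pow_of_mem hx]
      exact dvd_mul_right _ _
  exact (hL hg).2

theorem dvd_edgeCount_of_commutator_mem {g x : FreeGroup α} (h : ⁅g, x⁆ ∈ commutatorPow R n)
    (i : α) (q : FreeGroup α ⧸ R) :
    (n : ℤ) ∣ edgeCount R g i q + edgeCount R x i ((g : FreeGroup α ⧸ R)⁻¹ * q)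
      - (edgeCount R x i q + edgeCount R g i ((x : FreeGroup α ⧸ R)⁻¹ * q)) := by
  have e : g * x = ⁅g, x⁆ * (x * g) := by
    rw [commutatorElement_def]
    group
  rw [← edgeCount_mul, ← edgeCount_mul, e, edgeCount_mul_of_mem (commutatorPow_le_self h),
    add_sub_cancel_right]
  exact dvd_edgeCount_of_mem_commutatorPow h i q

/-- The projection `F / S → F / R` for `S ≤ R`. -/
def quotientProj (h : S ≤ R) : FreeGroup α ⧸ S →* FreeGroup α ⧸ R :=
  QuotientGroup.map S R (MonoidHom.id _) h

@[simp]
theorem quotientProj_mk (h : S ≤ R) (g : FreeGroup α) :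
    quotientProj h (g : FreeGroup α ⧸ S) = (g : FreeGroup α ⧸ R) := rfl

-- The path of `g` in `F / R` is the image of its path in `F / S`, so the edges above a given edge
-- contribute its count.
open Classical in
theorem edgeCount_eq_sum_fiber [Fintype (FreeGroup α ⧸ S)] (h : S ≤ R) (g : FreeGroup α) (i : α)
    (q : FreeGroup α ⧸ R) :
    edgeCount R g i q = ∑ p, if quotientProj h p = q then edgeCount S g i p else 0 := by
  have hof : ∀ (j : α) (q : FreeGroup α ⧸ R), edgeCount R (FreeGroup.of j) i q
      = ∑ p, if quotientProj h p = q then edgeCount S (FreeGroup.of j) i p else 0 := by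
    intro j q
    rw [Finset.sum_eq_single 1]
    · simp only [edgeCount_of, map_one, and_true, eq_comm (a := (1 : FreeGroup α ⧸ R))]
      split_ifs <;> simp_all
    · intro p _ hp
      simp [edgeCount_of, hp]
    · simp
  have hshift : ∀ (a : FreeGroup α) (q : FreeGroup α ⧸ R) (v : FreeGroup α ⧸ S → ℤ),
      (∑ p, if quotientProj h p = (a : FreeGroup α ⧸ R) * q then v p else 0)
        = ∑ p, if quotientProj h p = q then v ((a : FreeGroup α ⧸ S) * p) else 0 := by
    intro a q v
    refine (Fintype.sum_equiv (Equiv.mulLeft (a : FreeGroup α ⧸ S)) _ _ fun p => ?_).symm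
    simp
  induction g using FreeGroup.induction_on generalizing q with
  | C1 => simp
  | of j => exact hof j q
  | inv_of j _ =>
    rw [edgeCount_inv, hof, hshift]
    simp_rw [edgeCount_inv, ← Finset.sum_neg_distrib, neg_ite, neg_zero]
  | mul a b iha ihb =>
    rw [edgeCount_mul, iha, ihb, ← QuotientGroup.mk_inv, hshift, ← Finset.sum_add_distrib]
    refine Finset.sum_congr rfl fun p _ => ?_
    split_ifs <;> simp [edgeCount_mul]

/-- An element of `S` that is central modulo `[S, S] S ^ n` lies in `[R, R] R ^ k` if `k` divides
both `n` and the order modulo `S` of some element of `R`. -/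
theorem mem_commutatorPow_of_central [Finite α] [Finite (FreeGroup α ⧸ S)] (h : S ≤ R)
    (hkn : k ∣ n) {x : FreeGroup α} (hx : x ∈ R) (hxk : ∀ j : ℕ, x ^ j ∈ S → k ∣ j)
    {g : FreeGroup α} (hg : g ∈ S) (hgc : ∀ y, ⁅g, y⁆ ∈ commutatorPow S n) :
    g ∈ commutatorPow R k := by
  classical
  have := Fintype.ofFinite (FreeGroup α ⧸ S)
  have hsurj : Function.Surjective (quotientProj h) := by
    intro q
    induction q using QuotientGroup.induction_on with
    | H a => exact ⟨a, rfl⟩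
  have : Finite (FreeGroup α ⧸ R) := Finite.of_surjective _ hsurj
  refine mem_commutatorPow_of_dvd_edgeCount R (h hg) fun i q => ?_
  -- Commuting with `a`, read at the edge based at `a`: the counts of `a` cancel because `g ∈ S`.
  have hconst : ∀ p, (k : ℤ) ∣ edgeCount S g i p - edgeCount S g i 1 := by
    intro p
    induction p using QuotientGroup.induction_on with
    | H a =>
    have := dvd_edgeCount_of_commutator_mem (hgc a) i (a : FreeGroup α ⧸ S)
    rw [(QuotientGroup.eq_one_iff g).mpr hg, inv_one, one_mul, inv_mul_cancel,
      add_comm (edgeCount S a i _), add_sub_add_right_eq_sub] at this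
    exact (Int.natCast_dvd_natCast.mpr hkn).trans this
  -- Each fiber is as large as the kernel `R / S`, whose order is divisible by that of `x`.
  have hcard : k ∣ (Finset.univ.filter fun p => quotientProj h p = q).card := by
    rw [MonoidHom.card_fiber_eq_of_mem_range (quotientProj h) (hsurj q) (hsurj 1)]
    have hmem : (x : FreeGroup α ⧸ S) ∈ (quotientProj h).ker := (QuotientGroup.eq_one_iff x).mpr hx
    have h1 : orderOf (x : FreeGroup α ⧸ S) ∣ Nat.card (quotientProj h).ker := by
      rw [← Subgroup.orderOf_mk _ hmem]
      exact orderOf_dvd_natCard _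
    have h2 : Nat.card (quotientProj h).ker
        = (Finset.univ.filter fun p => quotientProj h p = 1).card := by
      rw [← Fintype.card_subtype, ← Nat.card_eq_fintype_card]
      rfl
    rw [← h2]
    refine (hxk _ ?_).trans h1
    rw [← QuotientGroup.eq_one_iff, QuotientGroup.mk_pow]
    exact pow_orderOf_eq_one _
  rw [edgeCount_eq_sum_fiber h, ← Finset.sum_filter]
  have : ∑ p with quotientProj h p = q, edgeCount S g i p
      = ∑ p with quotientProj h p = q, (edgeCount S g i p - edgeCount S g i 1)
        + (Finset.univ.filter fun p => quotientProj h p = q).card * edgeCount S g i 1 := by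
    simp
  rw [this]
  exact dvd_add (Finset.dvd_sum fun p _ => hconst p)
    ((Int.natCast_dvd_natCast.mpr hcard).mul_right _)

end EdgeCountMod

/-! ### Elements central modulo `K_{r,n}`. -/

section AsymptoticCenter

variable {α : Type*} {n : ℕ}

open Classical in
/-- The exponent sum modulo `n` of the generator `i`. -/
noncomputable def exponentSum (α : Type*) (n : ℕ) (i : α) :
    FreeGroup α →* Multiplicative (ZMod n) :=
  FreeGroup.lift fun j => if j = i then Multiplicative.ofAdd 1 else 1

theorem exponentSum_eq_one_of_mem {r : ℕ} (hr : 0 < r) (i : α) {g : FreeGroup α}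
    (hg : g ∈ powSeries (FreeGroup α) n r) : exponentSum α n i g = 1 := by
  have h : powSeries (FreeGroup α) n 1 ≤ (exponentSum α n i).ker := by
    refine commutatorPow_le_iff.mpr ⟨fun x _ y _ => ?_, fun x _ => ?_⟩
    · rw [MonoidHom.mem_ker, map_commutatorElement]
      exact commutatorElement_eq_one_iff_mul_comm.mpr (mul_comm _ _)
    · rw [MonoidHom.mem_ker, map_pow, ← toAdd_eq_zero, toAdd_pow, nsmul_eq_mul,
        ZMod.natCast_self, zero_mul]
  exact h (powSeries_antitone _ n hr hg)

theorem dvd_of_of_zpow_mem {r : ℕ} (hr : 0 < r) {i : α} {a : ℤ}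
    (h : FreeGroup.of i ^ a ∈ powSeries (FreeGroup α) n r) : (n : ℤ) ∣ a := by
  have := exponentSum_eq_one_of_mem hr i h
  rwa [map_zpow, exponentSum, FreeGroup.lift_apply_of, if_pos rfl, ← toAdd_eq_zero, toAdd_zpow,
    toAdd_ofAdd, zsmul_one, ZMod.intCast_zmod_eq_zero_iff_dvd] at this

theorem dvd_of_of_pow_mem {r : ℕ} (hr : 0 < r) {i : α} {a : ℕ}
    (h : FreeGroup.of i ^ a ∈ powSeries (FreeGroup α) n r) : n ∣ a := by
  rw [← zpow_natCast] at h
  exact Int.natCast_dvd_natCast.mp (dvd_of_of_zpow_mem hr h)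

/-- An element that is central modulo `K_{2,n}` is congruent modulo `K_{1,n}` to a power of any
given generator. -/
theorem exists_zpow_of_central (hn : 1 < n) {g : FreeGroup α}
    (hg : ∀ x, ⁅g, x⁆ ∈ powSeries (FreeGroup α) n 2) (i : α) :
    ∃ a : ℤ, (FreeGroup.of i ^ a)⁻¹ * g ∈ powSeries (FreeGroup α) n 1 := by
  classical
  by_contra! hne
  set S := powSeries (FreeGroup α) n 1 with hS
  set x : FreeGroup α := FreeGroup.of i
  have hxn : (x : FreeGroup α ⧸ S) ^ n = 1 := by
    rw [← QuotientGroup.mk_pow, QuotientGroup.eq_one_iff]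
    simpa using pow_mem_powSeries x n 1
  -- Along the cycle of powers of `x`, the counts of `g` are constant modulo `n` except for a jump
  -- of 1 on returning to the origin: no translate by `g` compensates, as `g` is not a power of `x`
  -- modulo `S`. The increments telescope to 0 around the cycle, forcing `n ∣ 1`.
  have hterm : ∀ t : ℕ, (n : ℤ) ∣ (edgeCount S g i ((x : FreeGroup α ⧸ S) ^ (t + 1))
      - edgeCount S g i ((x : FreeGroup α ⧸ S) ^ t)) - if n ∣ t + 1 then 1 else 0 := by
    intro t
    have h := dvd_edgeCount_of_commutator_mem (R := S) (hg x) i ((x : FreeGroup α ⧸ S) ^ (t + 1))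
    have h1 : (g : FreeGroup α ⧸ S)⁻¹ * (x : FreeGroup α ⧸ S) ^ (t + 1) ≠ 1 := by
      intro h1
      refine hne (t + 1 : ℕ) (QuotientGroup.eq.mp ?_)
      rw [zpow_natCast, QuotientGroup.mk_pow]
      exact (inv_mul_eq_one.mp h1).symm
    have h2 : (x : FreeGroup α ⧸ S) ^ (t + 1) = 1 ↔ n ∣ t + 1 := by
      rw [← QuotientGroup.mk_pow, QuotientGroup.eq_one_iff]
      refine ⟨dvd_of_of_pow_mem one_pos, ?_⟩
      rintro ⟨c, hc⟩
      rw [hc, pow_mul, ← QuotientGroup.eq_one_iff, QuotientGroup.mk_pow, QuotientGroup.mk_pow,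
        hxn, one_pow]
    rw [edgeCount_of, edgeCount_of, if_neg (fun h => h1 h.2), pow_succ', inv_mul_cancel_left,
      ← pow_succ'] at h
    simp only [true_and, h2] at h
    convert h using 1
    ring
  have hsum := Finset.dvd_sum fun t (_ : t ∈ Finset.range n) => hterm t
  rw [Finset.sum_sub_distrib, Finset.sum_range_sub (fun t => edgeCount S g i (x ^ t)), hxn,
    pow_zero, sub_self, zero_sub, dvd_neg, Finset.sum_eq_single (n - 1)] at hsum
  · rw [Nat.sub_add_cancel hn.le, if_pos dvd_rfl] at hsum
    have := Int.eq_one_of_dvd_one (by positivity) hsum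
    omega
  · intro t ht htn
    rw [if_neg]
    intro hd
    have := Nat.le_of_dvd t.succ_pos hd
    have := Finset.mem_range.mp ht
    omega
  · intro h
    exact absurd (Finset.mem_range.mpr (by omega)) h

/-- Modulo `K_{1,n}`, `g` is a power of each of two distinct generators; comparing exponent sums
makes both powers trivial. -/
theorem mem_powSeries_one_of_central [Nontrivial α] (hn : 1 < n) {g : FreeGroup α}
    (hg : ∀ x, ⁅g, x⁆ ∈ powSeries (FreeGroup α) n 2) : g ∈ powSeries (FreeGroup α) n 1 := by
  obtain ⟨i, j, hij⟩ := exists_pair_ne α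
  obtain ⟨a, ha⟩ := exists_zpow_of_central hn hg i
  obtain ⟨b, hb⟩ := exists_zpow_of_central hn hg j
  have hab : (FreeGroup.of i ^ a)⁻¹ * FreeGroup.of j ^ b ∈ powSeries (FreeGroup α) n 1 := by
    simpa using mul_mem ha (inv_mem hb)
  have hdvd : (n : ℤ) ∣ a := by
    have := exponentSum_eq_one_of_mem one_pos i hab
    rwa [map_mul, map_inv, map_zpow, map_zpow, exponentSum, FreeGroup.lift_apply_of,
      FreeGroup.lift_apply_of, if_pos rfl, if_neg hij.symm, one_zpow, mul_one, inv_eq_one,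
      ← toAdd_eq_zero, toAdd_zpow, toAdd_ofAdd, zsmul_one,
      ZMod.intCast_zmod_eq_zero_iff_dvd] at this
  obtain ⟨c, rfl⟩ := hdvd
  have hpow : FreeGroup.of i ^ ((n : ℤ) * c) ∈ powSeries (FreeGroup α) n 1 := by
    rw [zpow_mul, zpow_natCast]
    exact Subgroup.zpow_mem _ (by simpa using pow_mem_powSeries (FreeGroup.of i) n 1) c
  simpa using mul_mem hpow ha

/-- The exponent `k ^ (r + 1)` is chosen so that the `k ^ r`-th power of a generator, which lies in
`K_{r,k}`, still has order divisible by `k` modulo `K_{r,k^(r+1)}`. -/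
theorem mem_powSeries_succ_of_central [Finite α] [Nonempty α] {k r : ℕ} (hk : 0 < k) (hr : 0 < r)
    {g : FreeGroup α} (hg : g ∈ powSeries (FreeGroup α) (k ^ (r + 1)) r)
    (hgc : ∀ x, ⁅g, x⁆ ∈ powSeries (FreeGroup α) (k ^ (r + 1)) (r + 1)) :
    g ∈ powSeries (FreeGroup α) k (r + 1) := by
  obtain ⟨i⟩ := ‹Nonempty α›
  have hkn : k ∣ k ^ (r + 1) := dvd_pow_self k r.succ_ne_zero
  have := finiteIndex_powSeries (FreeGroup α) (pow_pos hk (r + 1)) r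
  refine mem_commutatorPow_of_central (powSeries_mono _ hkn r) hkn
    (pow_mem_powSeries (FreeGroup.of i) k r) (fun j hj => ?_) hg hgc
  rw [← pow_mul] at hj
  have := dvd_of_of_pow_mem hr hj
  rw [pow_succ] at this
  exact Nat.dvd_of_mul_dvd_mul_left (pow_pos hk r) this

/-- The preimages in `F` of the centers of the groups `F / K_{r,n}` become arbitrarily small. -/
theorem exists_forall_central_mem [Finite α] [Nontrivial α] {r : ℕ} (hr : 2 ≤ r) {k : ℕ}
    (hk : 0 < k) : ∃ n, 0 < n ∧ k ∣ n ∧ ∀ g : FreeGroup α,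
      (∀ x, ⁅g, x⁆ ∈ powSeries (FreeGroup α) n r) → g ∈ powSeries (FreeGroup α) k r := by
  induction r, hr using Nat.le_induction generalizing k with
  | base =>
    -- The factor 2 ensures that the exponent exceeds 1 even when `k = 1`.
    refine ⟨(2 * k) ^ 2, by positivity, (dvd_mul_left k 2).trans (dvd_pow_self _ two_ne_zero),
      fun g hg => powSeries_mono _ (dvd_mul_left k 2) 2 ?_⟩
    exact mem_powSeries_succ_of_central (by positivity) one_pos
      (mem_powSeries_one_of_central (Nat.one_lt_pow two_ne_zero (by omega)) hg) hg
  | succ r hr ih =>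
    obtain ⟨n, hn, hkn, h⟩ := ih (pow_pos hk (r + 1))
    refine ⟨n, hn, (dvd_pow_self k r.succ_ne_zero).trans hkn, fun g hg => ?_⟩
    exact mem_powSeries_succ_of_central hk (by omega)
      (h g fun x => powSeries_antitone _ n r.le_succ (hg x))
      fun x => powSeries_mono _ hkn _ (hg x)

end AsymptoticCenter

/-! ### Kernels of the maps on Aut and Out. -/

section Automorphisms

theorem finiteIndex_comap {G H : Type*} [Group G] [Group H] (f : G →* H) (K : Subgroup H)
    [K.FiniteIndex] : (K.comap f).FiniteIndex :=
  ⟨by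
    rw [Subgroup.index_comap]
    exact mt Subgroup.index_eq_zero_of_relIndex_eq_zero Subgroup.FiniteIndex.index_ne_zero⟩

variable {G Q : Type*} [Group G] [Group Q]

theorem mem_ker_autQuotient {K : Subgroup G} [K.Characteristic] {a : MulAut G} :
    a ∈ (autQuotient K).ker ↔ ∀ g, g⁻¹ * a g ∈ K := by
  rw [MonoidHom.mem_ker, MulEquiv.ext_iff]
  constructor
  · intro h g
    exact QuotientGroup.eq.mp (h (g : G ⧸ K)).symm
  · intro h x
    induction x using QuotientGroup.induction_on with
    | H g => exact (QuotientGroup.eq.mpr (h g)).symm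

theorem mem_ker_autMap (p : G →* Q) (hp : Function.Surjective p) [p.ker.Characteristic]
    {a : MulAut G} : a ∈ (autMap p hp).ker ↔ ∀ g, g⁻¹ * a g ∈ p.ker := by
  rw [MonoidHom.mem_ker, MulEquiv.ext_iff, hp.forall]
  refine forall_congr' fun g => ?_
  rw [autMap_apply, MonoidHom.mem_ker, map_mul, map_inv, inv_mul_eq_one, eq_comm]
  rfl

theorem ker_autQuotient_mono {K L : Subgroup G} [K.Characteristic] [L.Characteristic]
    (h : K ≤ L) : (autQuotient K).ker ≤ (autQuotient L).ker := fun _ ha =>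
  mem_ker_autQuotient.mpr fun g => h (mem_ker_autQuotient.mp ha g)

theorem outMap_mk (p : G →* Q) (hp : Function.Surjective p) [p.ker.Characteristic]
    (a : MulAut G) : outMap p hp (a : OutGroup G) = (autMap p hp a : OutGroup Q) := rfl

theorem autMap_conj (p : G →* Q) (hp : Function.Surjective p) [p.ker.Characteristic] (g : G) :
    autMap p hp (MulAut.conj g) = MulAut.conj (p g) := by
  ext x
  obtain ⟨y, rfl⟩ := hp x
  simp [autMap_apply]

end Automorphisms

section FreeSolvableGroups

variable {m r n k : ℕ}

theorem derivedSeries_freeSolvable (m r : ℕ) : derivedSeries (FreeSolvable m r) r = ⊥ := by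
  rw [← map_derivedSeries_eq (QuotientGroup.mk'_surjective _), Subgroup.map_eq_bot_iff,
    QuotientGroup.ker_mk']

theorem mk_mem_powSeries_iff {w : FreeGroup (Fin m)} :
    (w : FreeSolvable m r) ∈ powSeries (FreeSolvable m r) n r ↔
      w ∈ powSeries (FreeGroup (Fin m)) n r := by
  rw [← freeSolvableProj_ker]
  exact QuotientGroup.eq_one_iff w

/-- Comparing inner automorphisms rather than elements covers `r = 1`, where the group is abelian
and every `conj g` is trivial. -/
theorem exists_conj_eq_of_central (hm : 1 < m) (hr : 0 < r) (hk : 0 < k) :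
    ∃ n, 0 < n ∧ ∀ g : FreeSolvable m r,
      (∀ x, ⁅g, x⁆ ∈ powSeries (FreeSolvable m r) n r) →
        ∃ z ∈ powSeries (FreeSolvable m r) k r, MulAut.conj z = MulAut.conj g := by
  obtain rfl | hr2 : r = 1 ∨ 2 ≤ r := by omega
  · refine ⟨1, one_pos, fun g _ => ⟨1, one_mem _, ?_⟩⟩
    ext x
    have h : ⁅g, x⁆ ∈ derivedSeries (FreeSolvable m 1) 1 :=
      Subgroup.commutator_mem_commutator trivial trivial
    rw [derivedSeries_freeSolvable, Subgroup.mem_bot, commutatorElement_eq_one_iff_mul_comm] at h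
    rw [map_one, MulAut.one_apply, MulAut.conj_apply, h, mul_inv_cancel_right]
  · have := Fin.nontrivial_iff_two_le.mpr hm
    obtain ⟨n, hn, -, h⟩ := exists_forall_central_mem (α := Fin m) hr2 hk
    refine ⟨n, hn, fun g hg => ⟨g, ?_, rfl⟩⟩
    induction g using QuotientGroup.induction_on with
    | H w => exact mk_mem_powSeries_iff.mpr (h w fun x => mk_mem_powSeries_iff.mp (hg x))

theorem mem_ker_autMap_freeSolvableProj {a : MulAut (FreeSolvable m r)} :
    a ∈ (autMap (freeSolvableProj m r n) (freeSolvableProj_surjective m r n)).ker ↔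
      a ∈ (autQuotient (powSeries (FreeSolvable m r) n r)).ker := by
  rw [mem_ker_autMap, mem_ker_autQuotient, freeSolvableProj_ker]

theorem mk_mem_ker_freeSolvableOutMap {a : MulAut (FreeSolvable m r)} :
    (a : OutGroup (FreeSolvable m r)) ∈ (freeSolvableOutMap m r n).ker ↔
      ∃ g, a * (MulAut.conj g)⁻¹ ∈ (autQuotient (powSeries (FreeSolvable m r) n r)).ker := by
  rw [MonoidHom.mem_ker, freeSolvableOutMap, outMap_mk, QuotientGroup.eq_one_iff,
    MonoidHom.mem_range, (freeSolvableProj_surjective m r n).exists]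
  refine exists_congr fun g => ?_
  rw [← mem_ker_autMap_freeSolvableProj, MonoidHom.mem_ker, map_mul, map_inv, autMap_conj,
    mul_inv_eq_one, eq_comm]

end FreeSolvableGroups

theorem mainTheorem7 (m r : ℕ) (hm : 1 < m) (hr : 0 < r) :
    HasCSP (FreeSolvable m r) ↔
      ∀ U : Subgroup (OutGroup (FreeSolvable m r)), U.FiniteIndex →
        ∃ n : ℕ, 0 < n ∧ (freeSolvableOutMap m r n).ker ≤ U := by
  constructor
  · intro hcsp U hU
    let π : MulAut (FreeSolvable m r) →* OutGroup (FreeSolvable m r) := QuotientGroup.mk' _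
    obtain ⟨K, _, hK, hKU⟩ := hcsp (U.comap π) (finiteIndex_comap π U)
    obtain ⟨n, hn, hnK⟩ := exists_powSeries_le (derivedSeries_freeSolvable m r) K
    refine ⟨n, hn, fun y hy => ?_⟩
    induction y using QuotientGroup.induction_on with
    | H a =>
    obtain ⟨g, hg⟩ := mk_mem_ker_freeSolvableOutMap.mp hy
    have hmem : π (a * (MulAut.conj g)⁻¹) ∈ U := hKU (ker_autQuotient_mono hnK hg)
    have hconj : π (MulAut.conj g) = 1 := (QuotientGroup.eq_one_iff _).mpr ⟨g, rfl⟩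
    rwa [map_mul, map_inv, hconj, inv_one, mul_one] at hmem
  · intro hout H hH
    let π : MulAut (FreeSolvable m r) →* OutGroup (FreeSolvable m r) := QuotientGroup.mk' _
    have := finiteIndex_comap (MulAut.conj (G := FreeSolvable m r)) H
    obtain ⟨k, hk, hkH⟩ := exists_powSeries_le (derivedSeries_freeSolvable m r)
      (H.comap MulAut.conj)
    obtain ⟨n, hn, hnk⟩ := exists_conj_eq_of_central hm hr hk
    have hfi := finiteIndex_powSeries (FreeSolvable m r) hn r
    have : Finite (MulAut (FreeSolvable m r ⧸ powSeries (FreeSolvable m r) n r)) :=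
      Finite.of_injective _ DFunLike.coe_injective
    let C := (autQuotient (powSeries (FreeSolvable m r) n r)).ker
    -- Intersecting with `C` ensures that the inner correction `h⁻¹ * a` below also acts trivially
    -- modulo `K_{r,n}`.
    obtain ⟨l, hl, hlU⟩ := hout ((H ⊓ C).map π)
      ⟨ne_zero_of_dvd_ne_zero (Subgroup.FiniteIndex.index_ne_zero (H := H ⊓ C))
        (Subgroup.index_map_dvd _ (QuotientGroup.mk'_surjective _))⟩
    refine ⟨powSeries (FreeSolvable m r) (n * l) r, inferInstance,
      finiteIndex_powSeries _ (Nat.mul_pos hn hl) r, fun a ha => ?_⟩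
    have hal : (a : OutGroup (FreeSolvable m r)) ∈ (freeSolvableOutMap m r l).ker :=
      mk_mem_ker_freeSolvableOutMap.mpr ⟨1, by
        simpa using ker_autQuotient_mono (powSeries_mono _ (dvd_mul_left l n) r) ha⟩
    obtain ⟨h, ⟨hhH, hhC⟩, hha⟩ := hlU hal
    obtain ⟨g, hg⟩ := QuotientGroup.eq.mp hha
    have hgC : MulAut.conj g ∈ C := by
      rw [hg]
      exact C.mul_mem (C.inv_mem hhC) (ker_autQuotient_mono
        (powSeries_mono _ (dvd_mul_right n l) r) ha)
    obtain ⟨z, hz, hzg⟩ := hnk g fun x => by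
      -- The inverse of `x * (g * x⁻¹ * g⁻¹)` is `⁅g, x⁆`.
      have hx := inv_mem (mem_ker_autQuotient.mp hgC x⁻¹)
      simpa [commutatorElement_def, mul_assoc] using hx
    have hgH : MulAut.conj g ∈ H := hzg ▸ hkH hz
    rw [hg] at hgH
    simpa using H.mul_mem hhH hgH
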